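/- Let $\mathrm{Loc}$ be the category of locales (the opposite of the category of frames), let $\mathrm{Pos}_\omega$ be the category of posets in which every nonempty directed subset has a supremum, with functions preserving these suprema, let $\mathrm{Topoi}$ be the 2-category of Grothendieck topoi, geometric morphisms, and natural transformations between inverse images, and let $\mathrm{Acc}_\omega$ be the 2-category of accessible categories with directed colimits, functors preserving directed colimits, and natural transformations. Consider - $\mathsf{Sh}:\mathrm{Loc}\to\mathrm{Topoi}$, sending a locale to its topos of sheaves and a morphism $f:L\to M$ to the geometric morphism whose direct image is $F\mapsto F\circ f^{-1}$; - $\mathsf{pt}:\mathrm{Topoi}\to\mathrm{Acc}_\omega$, sending $\mathcal E$ to the category of functors $\mathcal E\to\mathrm{Set}$ preserving small colimits and finite limits, and a geometric morphism $f$ to $p^*\mapsto p^*\circ f^*$; - $\mathsf{pt}:\mathrm{Loc}\to\mathrm{Pos}_\omega$, sending $L$ to the set $\mathrm{Frm}(L,\{0<1\})$ of frame homomorphisms with the pointwise order, and acting on morphisms by precomposition; - the inclusion $i:\mathrm{Pos}_\omega\to\mathrm{Acc}_\omega$, viewing a poset as a category. The square formed by these four (pseudo)functors commutes up to pseudonatural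 equivalence: the pseudofunctors $i\circ\mathsf{pt}$ and $\mathsf{pt}\circ\mathsf{Sh}$ from $\mathrm{Loc}$ to $\mathrm{Acc}_\omega$ are equivalent. In particular, for every locale $L$ there is an equivalence of categories $\mathsf{pt}(L)\simeq\mathsf{pt}(\mathsf{Sh}(L))$. -/

import Mathlib

open CategoryTheory Limits Opposite Bicategory

universe u

/-! ### Posets with directed suprema -/

/-- A poset in which every nonempty directed subset has a supremum. -/
structure DirPos : Type (u + 1) where
  carrier : Type u
  [partialOrder : PartialOrder carrier]
  exists_isLUB : ∀ s : Set carrier, s.Nonempty → DirectedOn (· ≤ ·) s → ∃ a, IsLUB s a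

attribute [instance] DirPos.partialOrder

namespace DirPos

/-- A function preserving suprema of nonempty directed subsets. -/
@[ext]
structure Hom (P Q : DirPos.{u}) : Type u where
  toFun : P.carrier → Q.carrier
  scottContinuous : ScottContinuous toFun

/-- The category `Pos_ω`. -/
instance : Category DirPos.{u} where
  Hom := Hom
  id P := ⟨id, ScottContinuous.id⟩
  comp f g := ⟨g.toFun ∘ f.toFun, f.scottContinuous.comp g.scottContinuous⟩

end DirPos

/-! ### Accessible categories with directed colimits -/

/-- A (locally small, up to equivalence of hom-sets) accessible category with directed colimits;
directed colimits are expressed as small filtered colimits. -/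
structure AccCat : Type (u + 2) where
  carrier : Type (u + 1)
  [category : Category.{u + 1} carrier]
  [isAccessible : IsAccessibleCategory.{u} carrier]
  [hasDirectedColimits : HasFilteredColimitsOfSize.{u, u} carrier]

attribute [instance] AccCat.category AccCat.isAccessible AccCat.hasDirectedColimits

namespace AccCat

/-- A functor preserving directed colimits. -/
structure Hom (A B : AccCat.{u}) : Type (u + 1) where
  functor : A.carrier ⥤ B.carrier
  [preserves : PreservesFilteredColimitsOfSize.{u, u} functor]

attribute [instance] Hom.preserves

/-- A natural transformation. -/
@[ext]
structure Hom₂ {A B : AccCat.{u}} (F G : Hom A B) : Type (u + 1) where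
  nat : F.functor ⟶ G.functor

instance : CategoryStruct AccCat.{u} where
  Hom A B := Hom A B
  id A := { functor := 𝟭 A.carrier, preserves := ⟨fun _ _ _ ↦ inferInstance⟩ }
  comp F G :=
    { functor := F.functor ⋙ G.functor
      preserves := ⟨fun J _ _ ↦
        have := F.preserves.preserves_filtered_colimits J
        have := G.preserves.preserves_filtered_colimits J
        inferInstance⟩ }

instance (A B : AccCat.{u}) : Category (A ⟶ B) where
  Hom F G := Hom₂ F G
  id F := ⟨𝟙 F.functor⟩
  comp α β := ⟨α.nat ≫ β.nat⟩

section

variable {A B C : AccCat.{u}}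

@[simp] lemma id_functor (A : AccCat.{u}) : Hom.functor (𝟙 A) = 𝟭 A.carrier := rfl

@[simp] lemma comp_functor (F : A ⟶ B) (G : B ⟶ C) :
    Hom.functor (F ≫ G) = F.functor ⋙ G.functor := rfl

@[simp] lemma id_nat (F : A ⟶ B) : Hom₂.nat (𝟙 F) = 𝟙 F.functor := rfl

@[simp] lemma comp_nat {F G H : A ⟶ B} (α : F ⟶ G) (β : G ⟶ H) :
    Hom₂.nat (α ≫ β) = α.nat ≫ β.nat := rfl

@[ext]
lemma hom₂_ext {F G : A ⟶ B} {α β : F ⟶ G} (h : α.nat = β.nat) : α = β :=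
  Hom₂.ext h

/-- Constructor for invertible 2-cells. -/
@[simps]
def isoMk {F G : A ⟶ B} (e : F.functor ≅ G.functor) : F ≅ G where
  hom := ⟨e.hom⟩
  inv := ⟨e.inv⟩
  hom_inv_id := hom₂_ext e.hom_inv_id
  inv_hom_id := hom₂_ext e.inv_hom_id

end

/-- The 2-category `Acc_ω`. -/
instance : Bicategory AccCat.{u} where
  homCategory A B := inferInstance
  whiskerLeft F _ _ α := ⟨Functor.whiskerLeft F.functor α.nat⟩
  whiskerRight α H := ⟨Functor.whiskerRight α.nat H.functor⟩
  associator F G H := isoMk (F := (F ≫ G) ≫ H) (G := F ≫ G ≫ H)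
    (Functor.associator F.functor G.functor H.functor)
  leftUnitor F := isoMk (F := 𝟙 _ ≫ F) (G := F) F.functor.leftUnitor
  rightUnitor F := isoMk (F := F ≫ 𝟙 _) (G := F) F.functor.rightUnitor
  whiskerLeft_id := by intros; ext; simp
  whiskerLeft_comp := by intros; ext; simp
  id_whiskerLeft := by intros; ext; simp
  comp_whiskerLeft := by intros; ext; simp
  id_whiskerRight := by intros; ext; simp
  comp_whiskerRight := by intros; ext; simp
  whiskerRight_id := by intros; ext; simp
  whiskerRight_comp := by intros; ext; simp
  whisker_assoc := by intros; ext; simp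
  whisker_exchange := by intros; ext; simp
  pentagon := by intros; ext; simp
  triangle := by intros; ext; simp

section

variable {A B C : AccCat.{u}}

@[simp] lemma whiskerLeft_nat (F : A ⟶ B) {G H : B ⟶ C} (α : G ⟶ H) :
    Hom₂.nat (F ◁ α) = Functor.whiskerLeft F.functor α.nat := rfl

@[simp] lemma whiskerRight_nat {F G : A ⟶ B} (α : F ⟶ G) (H : B ⟶ C) :
    Hom₂.nat (α ▷ H) = Functor.whiskerRight α.nat H.functor := rfl

end

end AccCat

/-! ### Grothendieck topoi -/

/-- A Grothendieck topos: a locally small category equivalent to a category of sheaves of sets on a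
small site. -/
structure Topos : Type (u + 2) where
  carrier : Type (u + 1)
  [category : Category.{u} carrier]
  isTopos : ∃ (C : Type u) (_ : SmallCategory C) (J : GrothendieckTopology C),
    Nonempty (carrier ≌ Sheaf J (Type u))

attribute [instance] Topos.category

namespace Topos

/-- A geometric morphism. -/
structure Hom (E F : Topos.{u}) : Type (u + 1) where
  direct : E.carrier ⥤ F.carrier
  inverse : F.carrier ⥤ E.carrier
  adj : inverse ⊣ direct
  [lex : PreservesFiniteLimits inverse]

attribute [instance] Hom.lex

/-- A 2-cell between geometric morphisms: a natural transformation of inverse images. -/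
@[ext]
structure Hom₂ {E F : Topos.{u}} (f g : Hom E F) : Type (u + 1) where
  nat : f.inverse ⟶ g.inverse

instance : CategoryStruct Topos.{u} where
  Hom E F := Hom E F
  id E := { direct := 𝟭 E.carrier, inverse := 𝟭 E.carrier, adj := Adjunction.id }
  comp f g :=
    { direct := f.direct ⋙ g.direct
      inverse := g.inverse ⋙ f.inverse
      adj := g.adj.comp f.adj }

instance (E F : Topos.{u}) : Category (E ⟶ F) where
  Hom f g := Hom₂ f g
  id f := ⟨𝟙 f.inverse⟩
  comp α β := ⟨α.nat ≫ β.nat⟩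

section

variable {E F G : Topos.{u}}

@[simp] lemma id_inverse (E : Topos.{u}) : Hom.inverse (𝟙 E) = 𝟭 E.carrier := rfl

@[simp] lemma comp_inverse (f : E ⟶ F) (g : F ⟶ G) :
    Hom.inverse (f ≫ g) = g.inverse ⋙ f.inverse := rfl

@[simp] lemma id_nat (f : E ⟶ F) : Hom₂.nat (𝟙 f) = 𝟙 f.inverse := rfl

@[simp] lemma comp_nat {f g h : E ⟶ F} (α : f ⟶ g) (β : g ⟶ h) :
    Hom₂.nat (α ≫ β) = α.nat ≫ β.nat := rfl

@[ext]
lemma hom₂_ext {f g : E ⟶ F} {α β : f ⟶ g} (h : α.nat = β.nat) : α = β :=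
  Hom₂.ext h

/-- Constructor for invertible 2-cells. -/
@[simps]
def isoMk {f g : E ⟶ F} (e : f.inverse ≅ g.inverse) : f ≅ g where
  hom := ⟨e.hom⟩
  inv := ⟨e.inv⟩
  hom_inv_id := hom₂_ext e.hom_inv_id
  inv_hom_id := hom₂_ext e.inv_hom_id

end

/-- The 2-category of topoi and geometric morphisms. -/
instance : Bicategory Topos.{u} where
  homCategory E F := inferInstance
  whiskerLeft f _ _ α := ⟨Functor.whiskerRight α.nat f.inverse⟩
  whiskerRight α h := ⟨Functor.whiskerLeft h.inverse α.nat⟩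
  associator f g h := isoMk (f := (f ≫ g) ≫ h) (g := f ≫ g ≫ h)
    (Functor.associator h.inverse g.inverse f.inverse).symm
  leftUnitor f := isoMk (f := 𝟙 _ ≫ f) (g := f) f.inverse.rightUnitor
  rightUnitor f := isoMk (f := f ≫ 𝟙 _) (g := f) f.inverse.leftUnitor
  whiskerLeft_id := by intros; ext; simp
  whiskerLeft_comp := by intros; ext; simp
  id_whiskerLeft := by intros; ext; simp
  comp_whiskerLeft := by intros; ext; simp
  id_whiskerRight := by intros; ext; simp
  comp_whiskerRight := by intros; ext; simp
  whiskerRight_id := by intros; ext; simp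
  whiskerRight_comp := by intros; ext; simp
  whisker_assoc := by intros; ext; simp
  whisker_exchange := by intros; ext; simp
  pentagon := by intros; ext; simp
  triangle := by intros; ext; simp

section Mates

variable {E F G H : Topos.{u}}

@[simp] lemma whiskerLeft_nat (f : E ⟶ F) {g h : F ⟶ G} (α : g ⟶ h) :
    Hom₂.nat (f ◁ α) = Functor.whiskerRight α.nat f.inverse := rfl

@[simp] lemma whiskerRight_nat {f g : E ⟶ F} (α : f ⟶ g) (h : F ⟶ G) :
    Hom₂.nat (α ▷ h) = Functor.whiskerLeft h.inverse α.nat := rfl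

/-- The transformation of direct images corresponding to a 2-cell. -/
def mate {f g : E ⟶ F} (α : f ⟶ g) : g.direct ⟶ f.direct :=
  conjugateEquiv g.adj f.adj α.nat

lemma mate_injective {f g : E ⟶ F} {α β : f ⟶ g} (h : mate α = mate β) : α = β :=
  hom₂_ext ((conjugateEquiv g.adj f.adj).injective h)

/-- Geometric morphisms with isomorphic direct images are isomorphic. -/
def isoOfDirect {f g : E ⟶ F} (e : g.direct ≅ f.direct) : f ≅ g :=
  isoMk ((conjugateIsoEquiv g.adj f.adj).symm e)

@[simp] lemma mate_isoOfDirect_hom {f g : E ⟶ F} (e : g.direct ≅ f.direct) :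
    mate (isoOfDirect e).hom = e.hom :=
  (conjugateEquiv g.adj f.adj).apply_symm_apply e.hom

@[simp] lemma mate_isoOfDirect_inv {f g : E ⟶ F} (e : g.direct ≅ f.direct) :
    mate (isoOfDirect e).inv = e.inv :=
  (conjugateEquiv f.adj g.adj).apply_symm_apply e.inv

@[simp] lemma mate_id (f : E ⟶ F) : mate (𝟙 f) = 𝟙 f.direct :=
  conjugateEquiv_id f.adj

@[simp] lemma mate_comp {f g h : E ⟶ F} (α : f ⟶ g) (β : g ⟶ h) :
    mate (α ≫ β) = mate β ≫ mate α :=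
  (conjugateEquiv_comp h.adj g.adj f.adj β.nat α.nat).symm

@[simp] lemma mate_whiskerLeft (f : E ⟶ F) {g h : F ⟶ G} (α : g ⟶ h) :
    mate (f ◁ α) = Functor.whiskerLeft f.direct (mate α) :=
  conjugateEquiv_whiskerRight h.adj g.adj f.adj α.nat

@[simp] lemma mate_whiskerRight {f g : E ⟶ F} (α : f ⟶ g) (h : F ⟶ G) :
    mate (α ▷ h) = Functor.whiskerRight (mate α) h.direct :=
  conjugateEquiv_whiskerLeft g.adj f.adj h.adj α.nat

@[simp] lemma mate_associator_hom (f : E ⟶ F) (g : F ⟶ G) (h : G ⟶ H) :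
    mate (α_ f g h).hom = (Functor.associator f.direct g.direct h.direct).inv := by
  have h₁ : mate (α_ f g h).inv = (Functor.associator f.direct g.direct h.direct).hom :=
    conjugateEquiv_associator_hom h.adj g.adj f.adj
  have h₂ : mate (α_ f g h).inv ≫ mate (α_ f g h).hom = 𝟙 _ := by
    rw [← mate_comp, Iso.hom_inv_id, mate_id]
  rw [h₁] at h₂
  exact (Iso.eq_inv_comp _).2 h₂ |>.trans (Category.comp_id _)

@[simp] lemma mate_leftUnitor_hom (f : E ⟶ F) :
    mate (λ_ f).hom = f.direct.leftUnitor.inv :=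
  conjugateEquiv_rightUnitor_hom f.adj

@[simp] lemma mate_rightUnitor_hom (f : E ⟶ F) :
    mate (ρ_ f).hom = f.direct.rightUnitor.inv :=
  conjugateEquiv_leftUnitor_hom f.adj

end Mates

end Topos

/-! ### The points of a locale -/

namespace Locale.PT

lemma exists_isLUB {L : Type u} [Order.Frame L] (s : Set (PT L)) (hne : s.Nonempty)
    (hs : DirectedOn (· ≤ ·) s) :
    ∃ p : PT L, (∀ a, p a ↔ ∃ q ∈ s, q a) ∧ IsLUB s p := by
  obtain ⟨q₀, hq₀⟩ := hne
  let p : PT L :=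
    { toFun := fun a ↦ ∃ q ∈ s, q a
      map_inf' := fun a b ↦ by
        apply propext
        constructor
        · rintro ⟨q, hq, h⟩
          rw [map_inf] at h
          exact ⟨⟨q, hq, h.1⟩, ⟨q, hq, h.2⟩⟩
        · rintro ⟨⟨q, hq, h⟩, ⟨q', hq', h'⟩⟩
          obtain ⟨r, hr, h₁, h₂⟩ := hs q hq q' hq'
          refine ⟨r, hr, ?_⟩
          rw [map_inf]
          exact ⟨h₁ a h, h₂ b h'⟩
      map_top' := by
        apply propext
        refine ⟨fun _ ↦ trivial, fun _ ↦ ⟨q₀, hq₀, ?_⟩⟩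
        rw [map_top]
        trivial
      map_sSup' := fun S ↦ by
        apply propext
        simp only [map_sSup, sSup_image, iSup_Prop_eq]
        aesop }
  exact ⟨p, fun a ↦ Iff.rfl, fun q hq a h ↦ ⟨q, hq, h⟩, fun r hr a ⟨q, hq, h⟩ ↦ hr hq a h⟩

end Locale.PT

/-- The poset `Frm(L, {0 < 1})` of points of a locale, ordered pointwise. -/
def Locale.ptObj (L : Locale.{u}) : DirPos.{u} where
  carrier := Locale.PT L.unop
  exists_isLUB s hne hs := by
    obtain ⟨p, _, hp⟩ := Locale.PT.exists_isLUB s hne hs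
    exact ⟨p, hp⟩

/-- The functor of points `pt : Loc ⥤ Pos_ω`. -/
def locPt : Locale.{u} ⥤ DirPos.{u} where
  obj L := L.ptObj
  map {L M} f :=
    { toFun := fun p : Locale.PT L.unop ↦ (p.comp f.unop.hom : Locale.PT M.unop)
      scottContinuous := fun s hne hs p hp ↦ by
        obtain ⟨p', hp', hlub⟩ := Locale.PT.exists_isLUB s hne hs
        obtain rfl : p = p' := hp.unique hlub
        refine ⟨?_, fun r hr a h ↦ ?_⟩
        · rintro _ ⟨q, hq, rfl⟩ a h
          exact hp.1 hq _ h
        · obtain ⟨q, hq, h'⟩ := (hp' (f.unop.hom a)).1 h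
          exact hr ⟨q, hq, rfl⟩ a h' }

/-! ### Posets with directed suprema as accessible categories -/

namespace DirPos

variable (P : DirPos.{u})

/-- The element underlying an object of the category attached to a poset. -/
abbrev val {P : DirPos.{u}} (X : AsSmall.{u + 1} P.carrier) : P.carrier := AsSmall.down.obj X

instance (X Y : AsSmall.{u + 1} P.carrier) : Subsingleton (X ⟶ Y) :=
  ⟨fun _ _ ↦ ULift.ext _ _ (Subsingleton.elim _ _)⟩

/-- A cocone over a diagram in (the category attached to) a poset is a colimit cocone if its vertex
is a least upper bound. -/
def isColimitOfIsLUB {P : DirPos.{u}} {J : Type*} [Category* J] {D : J ⥤ AsSmall.{u + 1} P.carrier}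
    (c : Cocone D) (hc : IsLUB (Set.range fun j ↦ val (D.obj j)) (val c.pt)) : IsColimit c where
  desc s := ⟨homOfLE (hc.2 (by rintro _ ⟨j, rfl⟩; exact leOfHom (s.ι.app j).down))⟩
  fac _ _ := Subsingleton.elim _ _
  uniq _ _ _ := Subsingleton.elim _ _

lemma isLUB_of_isColimit {P : DirPos.{u}} {J : Type*} [Category* J]
    {D : J ⥤ AsSmall.{u + 1} P.carrier} {c : Cocone D} (hc : IsColimit c) :
    IsLUB (Set.range fun j ↦ val (D.obj j)) (val c.pt) := by
  constructor
  · rintro _ ⟨j, rfl⟩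
    exact leOfHom (c.ι.app j).down
  · intro b hb
    let s : Cocone D :=
      { pt := ⟨b⟩
        ι :=
          { app := fun j ↦ ⟨homOfLE (hb ⟨j, rfl⟩)⟩
            naturality := fun _ _ _ ↦ Subsingleton.elim _ _ } }
    exact leOfHom (hc.desc s).down

lemma range_nonempty {P : DirPos.{u}} {J : Type*} [Category* J] [IsFiltered J]
    (D : J ⥤ AsSmall.{u + 1} P.carrier) : (Set.range fun j ↦ val (D.obj j)).Nonempty :=
  have := IsFiltered.nonempty (C := J)
  Set.range_nonempty _

lemma directedOn_range {P : DirPos.{u}} {J : Type*} [Category* J] [IsFiltered J]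
    (D : J ⥤ AsSmall.{u + 1} P.carrier) :
    DirectedOn (· ≤ ·) (Set.range fun j ↦ val (D.obj j)) := by
  rintro _ ⟨i, rfl⟩ _ ⟨j, rfl⟩
  exact ⟨_, ⟨IsFiltered.max i j, rfl⟩, leOfHom (D.map (IsFiltered.leftToMax i j)).down,
    leOfHom (D.map (IsFiltered.rightToMax i j)).down⟩

instance : HasFilteredColimitsOfSize.{u, u} (AsSmall.{u + 1} P.carrier) where
  HasColimitsOfShape J _ _ :=
    { has_colimit := fun D ↦ by
        obtain ⟨a, ha⟩ := P.exists_isLUB (Set.range fun j ↦ val (D.obj j))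
          (range_nonempty D) (directedOn_range D)
        let c : Cocone D :=
          { pt := ⟨a⟩
            ι :=
              { app := fun j ↦ ⟨homOfLE (ha.1 ⟨j, rfl⟩)⟩
                naturality := fun _ _ _ ↦ Subsingleton.elim _ _ } }
        exact ⟨⟨c, isColimitOfIsLUB c ha⟩⟩ }

instance : IsAccessibleCategory.{u} (AsSmall.{u + 1} P.carrier) := by
  obtain ⟨κ, hκ, hP⟩ := HasCardinalLT.exists_regular_cardinal.{u} P.carrier
  have : Fact κ.IsRegular := ⟨hκ⟩
  refine ⟨κ, inferInstance, ?_⟩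
  have hls : LocallySmall.{u} (AsSmall.{u + 1} P.carrier) :=
    locallySmall_of_faithful (AsSmall.equiv (C := P.carrier)).inverse
  have hsm : Small.{u} (AsSmall.{u + 1} P.carrier) :=
    small_of_injective (β := P.carrier) (f := fun a ↦ val a) (by
      rintro ⟨a⟩ ⟨b⟩ h
      exact congrArg ULift.up h)
  have hcol : HasCardinalFilteredColimits (AsSmall.{u + 1} P.carrier) κ :=
    ⟨fun J _ _ ↦ by have := isFiltered_of_isCardinalFiltered J κ; infer_instance⟩
  have hpres (X : AsSmall.{u + 1} P.carrier) : IsCardinalPresentable X κ := by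
    refine ⟨fun J _ _ ↦ ⟨fun {D} ↦ ⟨fun {c} hc ↦ ?_⟩⟩⟩
    have := isFiltered_of_isCardinalFiltered J κ
    obtain ⟨j₀, hj₀⟩ : ∃ j₀ : J, ∀ j : J, val (D.obj j) ≤ val (D.obj j₀) := by
      let S : (Set.range fun j ↦ val (D.obj j)) → J := fun x ↦ x.2.choose
      have hS : HasCardinalLT (Set.range fun j ↦ val (D.obj j)) κ :=
        hP.of_injective _ Subtype.val_injective
      refine ⟨IsCardinalFiltered.max S hS, fun j ↦ ?_⟩
      have h₁ : val (D.obj (S ⟨_, ⟨j, rfl⟩⟩)) = val (D.obj j) :=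
        (⟨_, ⟨j, rfl⟩⟩ : (Set.range fun j ↦ val (D.obj j))).2.choose_spec
      rw [← h₁]
      exact leOfHom (D.map (IsCardinalFiltered.toMax S hS ⟨_, ⟨j, rfl⟩⟩)).down
    have h₂ : val c.pt ≤ val (D.obj j₀) :=
      (isLUB_of_isColimit hc).2 (by rintro _ ⟨j, rfl⟩; exact hj₀ j)
    let r : c.pt ⟶ D.obj j₀ := ⟨homOfLE h₂⟩
    exact ⟨Types.FilteredColimit.isColimitOf' _ _
      (fun f ↦ ⟨j₀, (show X ⟶ c.pt from f) ≫ r, Subsingleton.elim (α := X ⟶ c.pt) _ _⟩)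
      (fun i x y _ ↦ ⟨i, 𝟙 i, Subsingleton.elim (α := X ⟶ D.obj i) _ _⟩)⟩
  have hgen : (⊤ : ObjectProperty (AsSmall.{u + 1} P.carrier)).IsCardinalFilteredGenerator κ :=
    { le_isCardinalPresentable := fun X _ ↦ hpres X
      exists_colimitsOfShape := fun X ↦
        ⟨Discrete PUnit, inferInstance, isCardinalFiltered_of_hasTerminal _ κ, ⟨{
          diag := (Functor.const _).obj X
          ι := 𝟙 _
          isColimit := isColimitConstCocone _ _
          prop_diag_obj := fun _ ↦ trivial }⟩⟩ }
  exact { exists_generator := ⟨⊤, inferInstance, hgen⟩ }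

/-- The inclusion `i : Pos_ω ⥤ Acc_ω` on objects: a poset is viewed as a category. -/
abbrev toAccCat : AccCat.{u} where
  carrier := AsSmall.{u + 1} P.carrier

variable {P}

/-- A function preserving directed suprema, viewed as a functor. -/
def Hom.toFunctor {Q : DirPos.{u}} (f : P ⟶ Q) :
    AsSmall.{u + 1} P.carrier ⥤ AsSmall.{u + 1} Q.carrier :=
  AsSmall.down ⋙ f.scottContinuous.monotone.functor ⋙ AsSmall.up

instance {Q : DirPos.{u}} (f : P ⟶ Q) :
    PreservesFilteredColimitsOfSize.{u, u} (Hom.toFunctor f) where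
  preserves_filtered_colimits J _ _ :=
    ⟨fun {D} ↦ ⟨fun {c} hc ↦ ⟨isColimitOfIsLUB _ (by
      have := f.scottContinuous (range_nonempty D) (directedOn_range D) (isLUB_of_isColimit hc)
      rw [← Set.range_comp] at this
      exact this)⟩⟩⟩

lemma hom₂_subsingleton {A : AccCat.{u}} {F G : A ⟶ P.toAccCat} (α β : F ⟶ G) : α = β := by
  ext X
  exact ULift.ext _ _ (Subsingleton.elim _ _)

end DirPos

/-- The inclusion `i : Pos_ω ⥤ Acc_ω`. -/
def posToAcc : LocallyDiscrete DirPos.{u} ⥤ᵖ AccCat.{u} :=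
  LocallyDiscrete.mkPseudofunctor
    (fun P ↦ P.toAccCat)
    (fun {P Q} f ↦
      ({ functor := DirPos.Hom.toFunctor f
         preserves := inferInstanceAs (PreservesFilteredColimitsOfSize.{u, u}
          (DirPos.Hom.toFunctor f)) } : AccCat.Hom P.toAccCat Q.toAccCat))
    (fun P ↦ AccCat.isoMk (F := { functor := DirPos.Hom.toFunctor (𝟙 P) }) (G := 𝟙 P.toAccCat)
      (Iso.refl _))
    (fun _ _ ↦ AccCat.isoMk (Iso.refl _))
    (fun _ _ _ ↦ DirPos.hom₂_subsingleton _ _)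
    (fun _ ↦ DirPos.hom₂_subsingleton _ _)
    (fun _ ↦ DirPos.hom₂_subsingleton _ _)

/-! ### The topos of sheaves on a locale -/

/-- The canonical topology on a frame: a sieve on `U` is covering when `U` is the supremum of its
members. -/
def frameTopology (L : Type u) [Order.Frame L] : GrothendieckTopology L where
  sieves U := {S | sSup {V | ∃ f : V ⟶ U, S f} = U}
  top_mem' U := le_antisymm (sSup_le fun _ ⟨f, _⟩ ↦ leOfHom f) (le_sSup ⟨𝟙 U, trivial⟩)
  pullback_stable' U V S f hS := by
    refine le_antisymm (sSup_le fun _ ⟨f, _⟩ ↦ leOfHom f) ?_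
    have h : V = V ⊓ sSup {W | ∃ g : W ⟶ U, S g} := by
      rw [show sSup {W | ∃ g : W ⟶ U, S g} = U from hS]
      exact (inf_eq_left.2 (leOfHom f)).symm
    conv_lhs => rw [h, inf_sSup_eq]
    refine iSup₂_le fun W ⟨g, hg⟩ ↦ le_sSup ⟨homOfLE inf_le_left, ?_⟩
    exact S.downward_closed hg (homOfLE inf_le_right)
  transitive' U S hS R hR := by
    refine le_antisymm (sSup_le fun _ ⟨f, _⟩ ↦ leOfHom f) ?_
    conv_lhs => rw [← show sSup {W | ∃ g : W ⟶ U, S g} = U from hS]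
    refine sSup_le fun V ⟨f, hf⟩ ↦ ?_
    conv_lhs => rw [← show sSup {W | ∃ g : W ⟶ V, R.pullback f g} = V from hR hf]
    exact sSup_le fun W ⟨g, hg⟩ ↦ le_sSup ⟨g ≫ f, hg⟩

lemma mem_frameTopology {L : Type u} [Order.Frame L] {U : L} (S : Sieve U) :
    S ∈ frameTopology L U ↔ sSup {V | ∃ f : V ⟶ U, S f} = U := Iff.rfl

section FrameHom

variable {L M : Type u} [Order.Frame L] [Order.Frame M] (φ : FrameHom M L)

/-- The functor between the underlying posets of a frame homomorphism. -/
abbrev FrameHom.toFunctor : M ⥤ L := (OrderHomClass.mono φ).functor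

instance : RepresentablyFlat φ.toFunctor where
  cofiltered U :=
    { nonempty := ⟨StructuredArrow.mk (Y := ⊤) (homOfLE (by simp))⟩
      cone_objs := fun X Y ↦
        ⟨StructuredArrow.mk (Y := X.right ⊓ Y.right) (homOfLE (by
          change U ≤ φ (X.right ⊓ Y.right)
          rw [map_inf]
          exact le_inf (leOfHom X.hom) (leOfHom Y.hom))),
          StructuredArrow.homMk (homOfLE inf_le_left) (Subsingleton.elim _ _),
          StructuredArrow.homMk (homOfLE inf_le_right) (Subsingleton.elim _ _), trivial⟩
      cone_maps := fun X Y f g ↦ ⟨X, 𝟙 X, by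
        ext
        exact Subsingleton.elim _ _⟩ }

lemma FrameHom.coverPreserving :
    CoverPreserving (frameTopology M) (frameTopology L) φ.toFunctor where
  cover_preserve {U S} hS := by
    refine le_antisymm (sSup_le fun _ ⟨f, _⟩ ↦ leOfHom f) ?_
    conv_lhs => rw [← show sSup {W | ∃ g : W ⟶ U, S g} = U from hS]
    change φ _ ≤ _
    rw [map_sSup]
    refine sSup_le ?_
    rintro _ ⟨V, ⟨f, hf⟩, rfl⟩
    exact le_sSup ⟨φ.toFunctor.map f, Sieve.image_mem_functorPushforward _ _ hf⟩

instance : φ.toFunctor.IsContinuous (frameTopology M) (frameTopology L) :=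
  Functor.isContinuous_of_coverPreserving (compatiblePreservingOfFlat _ _) φ.coverPreserving

end FrameHom

/-- The topos of sheaves on a locale. -/
abbrev Locale.sheafTopos (L : Locale.{u}) : Topos.{u} where
  carrier := Sheaf (frameTopology L.unop) (Type u)
  isTopos := ⟨L.unop, inferInstance, frameTopology L.unop, ⟨CategoryTheory.Equivalence.refl⟩⟩

instance FrameHom.preservesFiniteLimits_sheafPullback {L M : Type u} [Order.Frame L]
    [Order.Frame M] (φ : FrameHom M L) :
    PreservesFiniteLimits (φ.toFunctor.sheafPullback (Type u)
      (frameTopology M) (frameTopology L)) :=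
  Functor.sheafPullbackConstruction.preservesFiniteLimits _ _ _ _

/-- The geometric morphism of sheaf topoi attached to a morphism of locales. Its direct image is
`F ↦ F ∘ f⁻¹`. -/
noncomputable abbrev Locale.sheafMap {L M : Locale.{u}} (f : L ⟶ M) : L.sheafTopos ⟶ M.sheafTopos :=
  ({ direct := f.unop.hom.toFunctor.sheafPushforwardContinuous (Type u)
        (frameTopology M.unop) (frameTopology L.unop)
     inverse := f.unop.hom.toFunctor.sheafPullback (Type u)
        (frameTopology M.unop) (frameTopology L.unop)
     adj := f.unop.hom.toFunctor.sheafAdjunctionContinuous (Type u)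
        (frameTopology M.unop) (frameTopology L.unop)
     lex := FrameHom.preservesFiniteLimits_sheafPullback _ } : Topos.Hom L.sheafTopos M.sheafTopos)

/-- The isomorphism `Sh(id) ≅ id`. -/
noncomputable def Locale.sheafMapId (L : Locale.{u}) :
    Locale.sheafMap (𝟙 L) ≅ 𝟙 L.sheafTopos :=
  Topos.isoOfDirect (Iso.refl _)

/-- The isomorphism `Sh(g ∘ f) ≅ Sh(g) ∘ Sh(f)`. -/
noncomputable def Locale.sheafMapComp {L M N : Locale.{u}} (f : L ⟶ M) (g : M ⟶ N) :
    Locale.sheafMap (f ≫ g) ≅ Locale.sheafMap f ≫ Locale.sheafMap g :=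
  Topos.isoOfDirect (Iso.refl _)

lemma Locale.mate_sheafMapId_hom (L : Locale.{u}) :
    Topos.mate L.sheafMapId.hom = 𝟙 (Topos.Hom.direct (𝟙 L.sheafTopos)) :=
  Topos.mate_isoOfDirect_hom _

lemma Locale.mate_sheafMapComp_hom {L M N : Locale.{u}} (f : L ⟶ M) (g : M ⟶ N) :
    Topos.mate (Locale.sheafMapComp f g).hom =
      𝟙 (Topos.Hom.direct (Locale.sheafMap f ≫ Locale.sheafMap g)) :=
  Topos.mate_isoOfDirect_hom _

lemma Locale.mate_sheafMapComp_inv {L M N : Locale.{u}} (f : L ⟶ M) (g : M ⟶ N) :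
    Topos.mate (Locale.sheafMapComp f g).inv =
      𝟙 (Topos.Hom.direct (Locale.sheafMap (f ≫ g))) :=
  Topos.mate_isoOfDirect_inv _

/-- The functor `Sh : Loc ⥤ Topoi`. -/
noncomputable def locSheaf : LocallyDiscrete Locale.{u} ⥤ᵖ Topos.{u} :=
  LocallyDiscrete.mkPseudofunctor
    (fun L ↦ L.sheafTopos)
    (fun f ↦ Locale.sheafMap f)
    (fun L ↦ L.sheafMapId)
    (fun f g ↦ Locale.sheafMapComp f g)
    (fun f g h ↦ by
      refine Eq.trans ?_ (rfl : 𝟙 (Locale.sheafMap ((f ≫ g) ≫ h)) = _)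
      apply Topos.mate_injective
      simp only [Topos.mate_comp, Topos.mate_whiskerLeft, Topos.mate_whiskerRight,
        Topos.mate_associator_hom, Locale.mate_sheafMapComp_hom, Locale.mate_sheafMapComp_inv]
      refine Eq.trans ?_ (Topos.mate_id (Locale.sheafMap ((f ≫ g) ≫ h))).symm
      ext F U x
      simp
      rfl)
    (fun f ↦ by
      refine Eq.trans ?_ (rfl : 𝟙 (Locale.sheafMap (𝟙 _ ≫ f)) = _)
      apply Topos.mate_injective
      simp only [Topos.mate_comp, Topos.mate_whiskerRight, Topos.mate_leftUnitor_hom,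
        Locale.mate_sheafMapComp_hom, Locale.mate_sheafMapId_hom]
      refine Eq.trans ?_ (Topos.mate_id (Locale.sheafMap (𝟙 _ ≫ f))).symm
      ext F U x
      simp
      rfl)
    (fun f ↦ by
      refine Eq.trans ?_ (rfl : 𝟙 (Locale.sheafMap (f ≫ 𝟙 _)) = _)
      apply Topos.mate_injective
      simp only [Topos.mate_comp, Topos.mate_whiskerLeft, Topos.mate_rightUnitor_hom,
        Locale.mate_sheafMapComp_hom, Locale.mate_sheafMapId_hom]
      refine Eq.trans ?_ (Topos.mate_id (Locale.sheafMap (f ≫ 𝟙 _))).symm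
      ext F U x
      simp
      rfl)

/-! ### Accessibility of categories of models -/

section Closure

/-- A downward Löwenheim–Skolem lemma. -/
lemma exists_closed_subset {S I : Type u} (op : I → S → S → S) (κ : Cardinal.{u})
    (hκ : Cardinal.aleph0 < κ) (hI : HasCardinalLT I κ) (A : Set S) (hA : HasCardinalLT A κ) :
    ∃ B : Set S, A ⊆ B ∧ HasCardinalLT B κ ∧ ∀ i, ∀ x ∈ B, ∀ y ∈ B, op i x y ∈ B := by
  let β : A ⊕ I → Type u := Sum.elim (fun _ ↦ PEmpty) (fun _ ↦ ULift Bool)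
  have hβ (a) : Finite (β a) := by
    rcases a with a | i
    · exact inferInstanceAs (Finite PEmpty)
    · exact inferInstanceAs (Finite (ULift Bool))
  let ev : WType β → S := WType.elim S (fun z ↦ match z with
    | ⟨Sum.inl a, _⟩ => a.1
    | ⟨Sum.inr i, g⟩ => op i (g ⟨true⟩) (g ⟨false⟩))
  have hW : HasCardinalLT (WType β) κ := by
    rw [hasCardinalLT_iff_cardinal_mk_lt]
    refine lt_of_le_of_lt (WType.cardinalMk_le_max_aleph0_of_finite (β := β)) (max_lt ?_ hκ)
    rw [← hasCardinalLT_iff_cardinal_mk_lt, hasCardinalLT_sum_iff _ _ _ hκ.le]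
    exact ⟨hA, hI⟩
  refine ⟨Set.range ev, fun a ha ↦ ⟨WType.mk (Sum.inl ⟨a, ha⟩) (fun z ↦ z.elim), rfl⟩,
    hW.of_surjective (Set.rangeFactorization ev) Set.rangeFactorization_surjective, ?_⟩
  rintro i _ ⟨s, rfl⟩ _ ⟨t, rfl⟩
  exact ⟨WType.mk (Sum.inr i) (fun z ↦ if z.down = true then s else t), by simp [ev, WType.elim]⟩

end Closure

section Models

variable {C : Type u} [SmallCategory C] (J : GrothendieckTopology C)

/-- The flat continuous functors on a small site. -/
def siteModel : ObjectProperty (C ⥤ Type u) := fun F ↦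
  IsCofiltered F.Elements ∧ ∀ ⦃X : C⦄ (R : Sieve X) (_ : R ∈ J X) (x : F.obj X),
    ∃ (Y : C) (f : Y ⟶ X) (_ : R f) (y : F.obj Y), F.map f y = x

/-- An elementary form of the definition of flat continuous functors. -/
lemma siteModel_iff (F : C ⥤ Type u) : siteModel J F ↔
    (∃ X, Nonempty (F.obj X)) ∧
    (∀ ⦃X Y : C⦄ (x : F.obj X) (y : F.obj Y), ∃ (Z : C) (f : Z ⟶ X) (g : Z ⟶ Y) (z : F.obj Z),
      F.map f z = x ∧ F.map g z = y) ∧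
    (∀ ⦃X Y : C⦄ (f g : X ⟶ Y) (x : F.obj X), F.map f x = F.map g x →
      ∃ (Z : C) (h : Z ⟶ X) (z : F.obj Z), h ≫ f = h ≫ g ∧ F.map h z = x) ∧
    (∀ ⦃X : C⦄ (R : Sieve X) (_ : R ∈ J X) (x : F.obj X),
      ∃ (Y : C) (f : Y ⟶ X) (_ : R f) (y : F.obj Y), F.map f y = x) := by
  constructor
  · rintro ⟨h, hJ⟩
    refine ⟨?_, ?_, ?_, hJ⟩
    · obtain ⟨⟨X, x⟩⟩ := h.nonempty
      exact ⟨X, ⟨x⟩⟩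
    · intro X Y x y
      obtain ⟨⟨Z, z⟩, ⟨f, hf⟩, ⟨g, hg⟩, -⟩ :=
        IsCofilteredOrEmpty.cone_objs (C := F.Elements) ⟨X, x⟩ ⟨Y, y⟩
      exact ⟨Z, f, g, z, hf, hg⟩
    · intro X Y f g x hfg
      obtain ⟨⟨Z, z⟩, ⟨k, hk⟩, hk'⟩ := IsCofilteredOrEmpty.cone_maps (C := F.Elements)
        (CategoryOfElements.homMk ⟨X, x⟩ ⟨Y, F.map g x⟩ f hfg)
        (CategoryOfElements.homMk ⟨X, x⟩ ⟨Y, F.map g x⟩ g rfl)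
      exact ⟨Z, k, z, congrArg Subtype.val hk', hk⟩
  · rintro ⟨⟨X, ⟨x⟩⟩, h₂, h₃, hJ⟩
    refine ⟨?_, hJ⟩
    exact
      { nonempty := ⟨⟨X, x⟩⟩
        cone_objs := by
          rintro ⟨X, x⟩ ⟨Y, y⟩
          obtain ⟨Z, f, g, z, hf, hg⟩ := h₂ x y
          exact ⟨⟨Z, z⟩, ⟨f, hf⟩, ⟨g, hg⟩, trivial⟩
        cone_maps := by
          rintro ⟨X, x⟩ ⟨Y, y⟩ ⟨f, hf⟩ ⟨g, hg⟩
          obtain ⟨Z, k, z, hk, hz⟩ := h₃ f g x (hf.trans hg.symm)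
          exact ⟨⟨Z, z⟩, ⟨k, hz⟩, Subtype.ext hk⟩ }

variable {J}

/-- Every small subset of a flat continuous functor is contained in a small flat continuous
subfunctor. -/
lemma exists_small_submodel {F : C ⥤ Type u} (hF : siteModel J F) (κ : Cardinal.{u})
    [Fact κ.IsRegular] (hκ : Cardinal.aleph0 < κ) (h₁ : HasCardinalLT (Arrow C) κ)
    (h₂ : HasCardinalLT (Σ X : C, Sieve X) κ)
    (A : Set (Σ X, F.obj X)) (hA : HasCardinalLT A κ) :
    ∃ G : Subfunctor F, siteModel J G.toFunctor ∧ HasCardinalLT (Σ X, G.obj X) κ ∧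
      ∀ a ∈ A, a.2 ∈ G.obj a.1 := by
  classical
  rw [siteModel_iff] at hF
  obtain ⟨⟨X₀, ⟨x₀⟩⟩, hF₂, hF₃, hF₄⟩ := hF
  let S := Σ X, F.obj X
  let I := (Σ (X : C) (Y : C), X ⟶ Y) ⊕ (Σ (X : C) (Y : C), (X ⟶ Y) × (X ⟶ Y)) ⊕
    (Σ X : C, Sieve X) ⊕ PUnit.{u + 1}
  choose pZ pf pg pz hpf hpg using hF₂
  choose eZ eh ez heh hez using hF₃
  choose sY sf sR sy hsy using hF₄
  let op : I → S → S → S := fun i a b ↦ match i with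
    | Sum.inl ⟨X, Y, f⟩ => if h : a.1 = X then ⟨Y, F.map (eqToHom h ≫ f) a.2⟩ else a
    | Sum.inr (Sum.inl ⟨X, Y, f, g⟩) =>
        if h : ∃ x : F.obj X, a = ⟨X, x⟩ ∧ F.map f x = F.map g x then
          ⟨_, ez f g h.choose h.choose_spec.2⟩ else a
    | Sum.inr (Sum.inr (Sum.inl ⟨X, R⟩)) =>
        if h : R ∈ J X ∧ ∃ x : F.obj X, a = ⟨X, x⟩ then ⟨_, sy R h.1 h.2.choose⟩ else a
    | Sum.inr (Sum.inr (Sum.inr _)) => ⟨_, pz a.2 b.2⟩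
  have hκ' := hκ.le
  have hArr : HasCardinalLT (Σ (X : C) (Y : C), X ⟶ Y) κ :=
    h₁.of_injective (fun f ↦ Arrow.mk f.2.2) (by
      rintro ⟨X, Y, f⟩ ⟨X', Y', f'⟩ h
      obtain rfl : X = X' := congrArg (fun a : Arrow C ↦ a.left) h
      obtain rfl : Y = Y' := congrArg (fun a : Arrow C ↦ a.right) h
      obtain rfl : f = f' := Arrow.mk_inj _ _ |>.1 h
      rfl)
  have hI : HasCardinalLT I κ := by
    simp only [I, hasCardinalLT_sum_iff _ _ _ hκ']
    refine ⟨hArr, ?_, h₂, hasCardinalLT_of_finite _ _ hκ'⟩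
    exact (hasCardinalLT_prod hκ' hArr hArr).of_injective
      (fun f ↦ (⟨f.1, f.2.1, f.2.2.1⟩, ⟨f.1, f.2.1, f.2.2.2⟩)) (by
        rintro ⟨X, Y, f, g⟩ ⟨X', Y', f', g'⟩ h
        simp only [Prod.mk.injEq, Sigma.mk.injEq] at h
        obtain ⟨⟨rfl, h⟩, ⟨-, h'⟩⟩ := h
        simp only [heq_eq_eq, Sigma.mk.injEq] at h h'
        obtain ⟨rfl, h⟩ := h
        obtain ⟨-, h'⟩ := h'
        simp only [heq_eq_eq] at h h'
        subst h h'
        rfl)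
  have hA' : HasCardinalLT (A ∪ {⟨X₀, x₀⟩} : Set S) κ :=
    hasCardinalLT_union hκ' hA (hasCardinalLT_of_finite _ _ hκ')
  obtain ⟨B, hAB, hB, hop⟩ := exists_closed_subset op κ hκ hI _ hA'
  have hmap {X Y : C} (f : X ⟶ Y) (x : F.obj X) (hx : ⟨X, x⟩ ∈ B) :
      (⟨Y, F.map f x⟩ : S) ∈ B := by
    simpa [op] using hop (Sum.inl ⟨X, Y, f⟩) _ hx _ hx
  let G : Subfunctor F :=
    { obj := fun X ↦ {x | (⟨X, x⟩ : S) ∈ B}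
      map := fun f x hx ↦ hmap f x hx }
  refine ⟨G, ?_, ?_, fun a ha ↦ hAB (Or.inl ha)⟩
  · rw [siteModel_iff]
    refine ⟨⟨X₀, ⟨⟨x₀, hAB (Or.inr rfl)⟩⟩⟩, ?_, ?_, ?_⟩
    · rintro X Y ⟨x, hx⟩ ⟨y, hy⟩
      exact ⟨_, pf x y, pg x y,
        ⟨pz x y, hop (Sum.inr (Sum.inr (Sum.inr ⟨⟩))) ⟨X, x⟩ hx ⟨Y, y⟩ hy⟩,
        Subtype.ext (hpf x y), Subtype.ext (hpg x y)⟩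
    · rintro X Y f g ⟨x, hx⟩ hfg
      have hfg' : F.map f x = F.map g x := congrArg Subtype.val hfg
      have := hop (Sum.inr (Sum.inl ⟨X, Y, f, g⟩)) _ hx _ hx
      have hex : ∃ x' : F.obj X, (⟨X, x⟩ : S) = ⟨X, x'⟩ ∧ F.map f x' = F.map g x' :=
        ⟨x, rfl, hfg'⟩
      have hch : hex.choose = x := (eq_of_heq (Sigma.mk.inj hex.choose_spec.1).2).symm
      simp only [op, dif_pos hex] at this
      refine ⟨_, eh f g hex.choose hex.choose_spec.2, ⟨_, this⟩, heh f g hex.choose hex.choose_spec.2, Subtype.ext ?_⟩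
      exact (hez f g hex.choose hex.choose_spec.2).trans hch
    · rintro X R hR ⟨x, hx⟩
      have := hop (Sum.inr (Sum.inr (Sum.inl ⟨X, R⟩))) _ hx _ hx
      have hex : R ∈ J X ∧ ∃ x' : F.obj X, (⟨X, x⟩ : S) = ⟨X, x'⟩ := ⟨hR, x, rfl⟩
      have hch : hex.2.choose = x := (eq_of_heq (Sigma.mk.inj hex.2.choose_spec).2).symm
      simp only [op, dif_pos hex] at this
      refine ⟨_, sf R hex.1 hex.2.choose, sR R hex.1 hex.2.choose, ⟨_, this⟩, Subtype.ext ?_⟩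
      exact (hsy R hex.1 hex.2.choose).trans hch
  · exact hB.of_injective (fun a : (Σ X, G.obj X) ↦ (⟨⟨a.1, a.2.1⟩, a.2.2⟩ : B)) (by
      rintro ⟨X, x, hx⟩ ⟨Y, y, hy⟩ h
      have h' := congrArg Subtype.val h
      obtain rfl : X = Y := congrArg Sigma.fst h'
      obtain rfl : x = y := eq_of_heq (Sigma.mk.inj h').2
      rfl)

lemma isCardinalPresentable_coyoneda (X : Cᵒᵖ) (κ : Cardinal.{u}) [Fact κ.IsRegular] :
    IsCardinalPresentable (coyoneda.obj X) κ where
  preservesColimitOfShape K _ _ := by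
    let e : coyoneda.obj (op (coyoneda.obj X)) ≅ (evaluation C (Type u)).obj X.unop :=
      NatIso.ofComponents (fun P ↦ Equiv.toIso coyonedaEquiv)
    exact preservesColimitsOfShape_of_natIso e.symm

lemma isCardinalPresentable_of_elements (F : C ⥤ Type u) (κ : Cardinal.{u}) [Fact κ.IsRegular]
    (hκ : Cardinal.aleph0 < κ) (h₁ : HasCardinalLT (Arrow C) κ)
    (hF : HasCardinalLT (Σ X, F.obj X) κ) : IsCardinalPresentable F κ := by
  have (k : F.Elementsᵒᵖ) : IsCardinalPresentable
      (((CategoryOfElements.π F).op ⋙ shrinkYoneda.{u}.flip).obj k) κ := by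
    have e : coyoneda.obj (op k.unop.1) ≅
        ((CategoryOfElements.π F).op ⋙ shrinkYoneda.{u}.flip).obj k :=
      ((flipFunctor _ _ _).mapIso (shrinkYonedaIsoYoneda.{u} (C := C))).symm.app (op k.unop.1)
    have := isCardinalPresentable_coyoneda (op k.unop.1) κ
    exact isCardinalPresentable_of_iso e κ
  refine isCardinalPresentable_of_isColimit _
    (Functor.Elements.isColimitCoconeπOpCompShrinkYonedaFlip F) κ ?_
  refine (hasCardinalLT_prod hκ.le h₁ hF).of_injective
    (fun a ↦ (Arrow.mk a.hom.unop.1, ⟨a.right.unop.1, a.right.unop.2⟩)) ?_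
  rintro ⟨⟨⟨X, x⟩⟩, ⟨⟨Y, y⟩⟩, ⟨f, hf⟩⟩ ⟨⟨⟨X', x'⟩⟩, ⟨⟨Y', y'⟩⟩, ⟨f', hf'⟩⟩ h
  have h₁ := congrArg Prod.fst h
  have h₂ := congrArg Prod.snd h
  dsimp at f f' h₁ h₂ hf hf'
  obtain rfl : Y = Y' := congrArg Sigma.fst h₂
  obtain rfl : y = y' := eq_of_heq (Sigma.mk.inj h₂).2
  obtain rfl : X = X' := congrArg (fun a : Arrow C ↦ a.right) h₁
  obtain rfl : f = f' := (Arrow.mk_inj _ _).1 h₁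
  obtain rfl : x = x' := hf.symm.trans hf'
  rfl

lemma siteModel_closed (K : Type u) [SmallCategory K] [IsFiltered K] :
    (siteModel J).IsClosedUnderColimitsOfShape K where
  colimitsOfShape_le := by
    rintro F ⟨p⟩
    have hp (X : C) := isColimitOfPreserves ((evaluation C (Type u)).obj X) p.isColimit
    have hs {X : C} (x : F.obj X) : ∃ (k : K) (y : (p.diag.obj k).obj X),
        (p.ι.app k).app X y = x :=
      Types.jointly_surjective_of_isColimit (hp X) x
    have hnat {X Y : C} (f : X ⟶ Y) {k : K} (y : (p.diag.obj k).obj X) :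
        F.map f ((p.ι.app k).app X y) = (p.ι.app k).app Y ((p.diag.obj k).map f y) :=
      (NatTrans.naturality_apply (p.ι.app k) f y).symm
    have hw {X : C} {k l : K} (a : k ⟶ l) (y : (p.diag.obj k).obj X) :
        (p.ι.app l).app X ((p.diag.map a).app X y) = (p.ι.app k).app X y :=
      ConcreteCategory.congr_hom (show (p.diag.map a).app X ≫ (p.ι.app l).app X =
        (p.ι.app k).app X from congr_app (p.cocone.w a) X) y
    have hD (k : K) := (siteModel_iff J _).1 (p.prop_diag_obj k)
    rw [siteModel_iff]
    refine ⟨?_, ?_, ?_, ?_⟩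
    · obtain ⟨k⟩ := IsFiltered.nonempty (C := K)
      obtain ⟨X, ⟨x⟩⟩ := (hD k).1
      exact ⟨X, ⟨(p.ι.app k).app X x⟩⟩
    · intro X Y x y
      obtain ⟨k, x, rfl⟩ := hs x
      obtain ⟨l, y, rfl⟩ := hs y
      let m := IsFiltered.max k l
      obtain ⟨Z, f, g, z, hf, hg⟩ := (hD m).2.1
        ((p.diag.map (IsFiltered.leftToMax k l)).app X x)
        ((p.diag.map (IsFiltered.rightToMax k l)).app Y y)
      refine ⟨Z, f, g, (p.ι.app m).app Z z, ?_, ?_⟩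
      · rw [hnat, hf, hw]
      · rw [hnat, hg, hw]
    · intro X Y f g x hx
      obtain ⟨k, x, rfl⟩ := hs x
      rw [hnat, hnat] at hx
      obtain ⟨l, a, ha⟩ := (Types.FilteredColimit.isColimit_eq_iff' (hp Y) _ _).1 hx
      obtain ⟨Z, h, z, hh, hz⟩ := (hD l).2.2.1 f g ((p.diag.map a).app X x) (by
        rw [← NatTrans.naturality_apply, ← NatTrans.naturality_apply]
        exact ha)
      refine ⟨Z, h, (p.ι.app l).app Z z, hh, ?_⟩
      rw [hnat, hz, hw]
    · intro X R hR x
      obtain ⟨k, x, rfl⟩ := hs x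
      obtain ⟨Y, f, hf, y, rfl⟩ := (hD k).2.2.2 R hR x
      exact ⟨Y, f, hf, (p.ι.app k).app Y y, hnat _ _⟩

/-- A full subcategory of a locally presentable category is accessible if it is closed under
filtered colimits and every object is a suitably filtered colimit of presentable objects. -/
lemma isAccessibleCategory_fullSubcategory {K : Type (u + 1)} [Category.{u} K]
    (P : ObjectProperty K) (κ : Cardinal.{u}) [Fact κ.IsRegular] [IsCardinalLocallyPresentable K κ]
    (hP : ∀ (I : Type u) [SmallCategory I] [IsFiltered I], P.IsClosedUnderColimitsOfShape I)
    (h : ∀ X, P X → ∃ (I : Type u) (_ : SmallCategory I) (_ : IsCardinalFiltered I κ),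
      (P ⊓ isCardinalPresentable K κ).colimitsOfShape I X) :
    IsAccessibleCategory.{u} P.FullSubcategory := by
  have hP' (I : Type u) [SmallCategory I] [IsCardinalFiltered I κ] :
      P.IsClosedUnderColimitsOfShape I :=
    have := isFiltered_of_isCardinalFiltered I κ
    hP I
  have h₁ : HasCardinalFilteredColimits P.FullSubcategory κ :=
    ⟨fun I _ _ ↦ by have := hP' I; infer_instance⟩
  let Q : ObjectProperty P.FullSubcategory := (isCardinalPresentable K κ).inverseImage P.ι
  have hQ : ObjectProperty.EssentiallySmall.{u} Q := by
    have : ObjectProperty.EssentiallySmall.{u} (P ⊓ isCardinalPresentable K κ) :=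
      ObjectProperty.EssentiallySmall.of_le (Q := isCardinalPresentable K κ) inf_le_right
    obtain ⟨R, _, hR, hR'⟩ := ObjectProperty.EssentiallySmall.exists_small_le.{u}
      (P ⊓ isCardinalPresentable K κ)
    refine ⟨R.inverseImage P.ι, ?_, ?_⟩
    · refine small_of_injective (β := Subtype R) (f := fun X ↦ ⟨X.1.obj, X.2⟩) ?_
      rintro ⟨⟨X, _⟩, _⟩ ⟨⟨Y, _⟩, _⟩ h
      obtain rfl : X = Y := congrArg Subtype.val h
      rfl
    · intro X hX
      obtain ⟨Y, hY, ⟨e⟩⟩ := hR' X.obj ⟨X.property, hX⟩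
      exact ⟨⟨Y, (hR _ hY).1⟩, hY, ⟨P.isoMk e⟩⟩
  refine ⟨κ, inferInstance, ?_⟩
  exact
    { toHasCardinalFilteredColimits := h₁
      toLocallySmall := inferInstance
      exists_generator := ⟨Q, hQ, by
        constructor
        · intro X hX
          refine ⟨fun I _ _ ↦ ?_⟩
          have := hP' I
          have : IsCardinalPresentable X.obj κ := hX
          have := preservesColimitsOfShape_of_isCardinalPresentable X.obj κ I
          let e : coyoneda.obj (op X) ≅ P.ι ⋙ coyoneda.obj (op X.obj) :=
            NatIso.ofComponents (fun Y ↦ P.fullyFaithfulι.homEquiv.toIso)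
          exact preservesColimitsOfShape_of_natIso e.symm
        · intro X
          obtain ⟨I, _, _, ⟨p⟩⟩ := h X.obj X.property
          let c : Cocone (P.lift p.diag fun i ↦ (p.prop_diag_obj i).1) :=
            { pt := X
              ι := { app := fun i ↦ P.homMk (p.ι.app i)
                     naturality := fun i j f ↦ by ext; exact p.ι.naturality f } }
          exact ⟨I, inferInstance, inferInstance, ⟨{
            diag := P.lift p.diag fun i ↦ (p.prop_diag_obj i).1
            ι := c.ι
            isColimit := isColimitOfReflects P.ι (c := c) p.isColimit
            prop_diag_obj := fun i ↦ (p.prop_diag_obj i).2 }⟩⟩⟩ }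

lemma exists_colimit_of_small_submodels {F : C ⥤ Type u} (hF : siteModel J F) (κ : Cardinal.{u})
    [Fact κ.IsRegular] (hκ : Cardinal.aleph0 < κ) (h₁ : HasCardinalLT (Arrow C) κ)
    (h₂ : HasCardinalLT (Σ X : C, Sieve X) κ) :
    ∃ (I : Type u) (_ : SmallCategory I) (_ : IsCardinalFiltered I κ),
      (siteModel J ⊓ isCardinalPresentable (C ⥤ Type u) κ).colimitsOfShape I F := by
  let I := {G : Subfunctor F // siteModel J G.toFunctor ∧ HasCardinalLT (Σ X, G.obj X) κ}
  have hI : IsCardinalFiltered I κ := isCardinalFiltered_preorder _ _ (fun T s hT ↦ by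
    obtain ⟨G, hG, hG', hG''⟩ := exists_small_submodel hF κ hκ h₁ h₂
      (⋃ t, Set.range (fun a : (Σ X, (s t).1.obj X) ↦ (⟨a.1, a.2.1⟩ : Σ X, F.obj X)))
      (hasCardinalLT_iUnion _ (by rwa [hasCardinalLT_iff_cardinal_mk_lt])
        (fun t ↦ (s t).2.2.of_surjective _ Set.rangeFactorization_surjective))
    exact ⟨⟨G, hG, hG'⟩, fun t X x hx ↦ hG'' ⟨X, x⟩ (Set.mem_iUnion.2 ⟨t, ⟨⟨X, x, hx⟩, rfl⟩⟩)⟩)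
  have := isFiltered_of_isCardinalFiltered I κ
  let D : I ⥤ C ⥤ Type u :=
    { obj := fun G ↦ G.1.toFunctor
      map := fun f ↦ Subfunctor.homOfLe (leOfHom f) }
  let c : Cocone D :=
    { pt := F
      ι := { app := fun G ↦ G.1.ι } }
  have hc : IsColimit c := evaluationJointlyReflectsColimits _ (fun X ↦
    Types.FilteredColimit.isColimitOf' _ _ (fun x ↦ by
      obtain ⟨G, hG, hG', hG''⟩ := exists_small_submodel hF κ hκ h₁ h₂ {⟨X, x⟩}
        (hasCardinalLT_of_finite _ _ hκ.le)
      exact ⟨⟨G, hG, hG'⟩, ⟨x, hG'' _ rfl⟩, rfl⟩)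
      (fun G x y h ↦ ⟨G, 𝟙 G, by
        obtain rfl : x = y := Subtype.ext h
        rfl⟩))
  exact ⟨I, inferInstance, hI, ⟨{
    diag := D
    ι := c.ι
    isColimit := hc
    prop_diag_obj := fun G ↦ ⟨G.2.1, isCardinalPresentable_of_elements _ κ hκ h₁ G.2.2⟩ }⟩⟩

variable (J) in
lemma isAccessibleCategory_siteModel : IsAccessibleCategory.{u} (siteModel J).FullSubcategory := by
  obtain ⟨κ, h, hκ⟩ := HasCardinalLT.exists_regular_cardinal_forall.{u}
    (fun i : Fin 3 ↦ match i with
      | 0 => ULift.{u} ℕ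
      | 1 => Arrow C
      | 2 => (Σ X : C, Sieve X))
  have : Fact κ.IsRegular := ⟨h⟩
  have h₀ : Cardinal.aleph0 < κ := by
    have := hκ 0
    simpa [hasCardinalLT_iff_cardinal_mk_lt] using this
  have : IsCardinalLocallyPresentable (C ⥤ Type u) κ :=
    (opOpEquivalence C).congrLeft.isCardinalLocallyPresentable κ
  exact isAccessibleCategory_fullSubcategory _ κ (fun I _ _ ↦ siteModel_closed I)
    (fun F hF ↦ exists_colimit_of_small_submodels hF κ h₀ (hκ 1) (hκ 2))

end Models

/-! ### The points of a topos -/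

/-- The points of a topos `E`: functors `E ⥤ Set` preserving small colimits and finite limits. -/
def isPoint (E : Type (u + 1)) [Category.{u} E] : ObjectProperty (E ⥤ Type u) := fun p ↦
  PreservesColimitsOfSize.{u, u} p ∧ PreservesFiniteLimits p

/-- The category of points of a topos. -/
abbrev PointCat (E : Type (u + 1)) [Category.{u} E] : Type (u + 1) := (isPoint E).FullSubcategory

namespace PointCat

section

variable {E : Type (u + 1)} [Category.{u} E]

instance (p : PointCat E) : PreservesColimitsOfSize.{u, u} p.obj := p.property.1

instance (p : PointCat E) : PreservesFiniteLimits p.obj := p.property.2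

instance (I : Type u) [SmallCategory I] [IsFiltered I] :
    (isPoint E).IsClosedUnderColimitsOfShape I where
  colimitsOfShape_le := by
    rintro p ⟨h⟩
    have h₁ (i : I) := (h.prop_diag_obj i).1
    have h₂ (i : I) := (h.prop_diag_obj i).2
    refine ⟨⟨fun {K} _ ↦ ⟨fun {D} ↦ ⟨fun {c} hc ↦ ?_⟩⟩⟩, ?_⟩
    · have hflip : PreservesColimitsOfShape K h.diag.flip := ⟨fun {D} ↦ ⟨fun {c} hc ↦
        ⟨evaluationJointlyReflectsColimits _ (fun i ↦ isColimitOfPreserves (h.diag.obj i) hc)⟩⟩⟩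
      let e : h.diag.flip ⋙ colim ≅ p := NatIso.ofComponents
        (fun X ↦ (colimit.isColimit (h.diag.flip.obj X)).coconePointUniqueUpToIso
          (isColimitOfPreserves ((evaluation _ _).obj X) h.isColimit))
        (fun f ↦ colimit.hom_ext (fun i ↦ by
          have h₁ (X : E) := (colimit.isColimit
            (h.diag.flip.obj X)).comp_coconePointUniqueUpToIso_hom
              (isColimitOfPreserves ((evaluation _ _).obj X) h.isColimit) i
          refine (ι_colimMap_assoc (h.diag.flip.map f) i _).trans ?_
          refine ((h.diag.obj i).map f ≫= h₁ _).trans ?_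
          refine ((h.ι.app i).naturality f).trans ?_
          refine Eq.trans ?_ (Category.assoc _ _ _)
          exact (h₁ _ =≫ p.map f).symm))
      have := preservesColimitsOfShape_of_natIso (J := K) e
      exact ⟨isColimitOfPreserves p hc⟩
    · exact (ObjectProperty.preservesFiniteLimits (J := E) (C := Type u)).prop_of_isColimit
        h.isColimit h₂

instance : HasFilteredColimitsOfSize.{u, u} (PointCat E) :=
  ⟨fun _ _ _ ↦ inferInstance⟩

end

section

variable {C : Type u} [SmallCategory C] (J : GrothendieckTopology C)

/-- Any element of a cocontinuous set-valued functor on presheaves comes from a representable. -/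
lemma exists_uliftYoneda (q : (Cᵒᵖ ⥤ Type u) ⥤ Type u) [PreservesColimitsOfSize.{u, u} q]
    {P : Cᵒᵖ ⥤ Type u} (t : q.obj P) :
    ∃ (X : C) (f : uliftYoneda.{u}.obj X ⟶ P) (s : q.obj (uliftYoneda.{u}.obj X)),
      q.map f s = t := by
  obtain ⟨X, s, hs⟩ := Types.jointly_surjective_of_isColimit
    (isColimitOfPreserves q (Presheaf.colimitOfRepresentable.{u} P)) t
  exact ⟨_, _, s, hs⟩

lemma bijective_whiskerLeft_uliftYoneda (q q' : (Cᵒᵖ ⥤ Type u) ⥤ Type u)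
    [PreservesColimitsOfSize.{u, u} q] :
    Function.Bijective (fun τ : q ⟶ q' ↦ Functor.whiskerLeft (uliftYoneda.{u} (C := C)) τ) := by
  have := Presheaf.isLeftKanExtension_of_preservesColimits.{u, u} q
    (Iso.refl (uliftYoneda.{u} (C := C) ⋙ q))
  have h := (q.homEquivOfIsLeftKanExtension (Iso.refl (uliftYoneda.{u} (C := C) ⋙ q)).hom
    q').bijective
  convert h using 1
  ext τ : 1
  exact (Category.id_comp _).symm

lemma isCofiltered_elements_uliftYoneda (q : (Cᵒᵖ ⥤ Type u) ⥤ Type u)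
    [PreservesColimitsOfSize.{u, u} q] [PreservesFiniteLimits q] :
    IsCofiltered (uliftYoneda.{u} (C := C) ⋙ q).Elements := by
  have := q.isCofiltered_elements
  let F : (uliftYoneda.{u} (C := C) ⋙ q).Elements ⥤ q.Elements :=
    { obj := fun x ↦ ⟨uliftYoneda.{u}.obj x.1, x.2⟩
      map := fun f ↦ ⟨uliftYoneda.{u}.map f.1, f.2⟩
      map_id := fun _ ↦ Subtype.ext (uliftYoneda.{u}.map_id _)
      map_comp := fun _ _ ↦ Subtype.ext (uliftYoneda.{u}.map_comp _ _) }
  have : F.Faithful := ⟨fun h ↦ Subtype.ext (uliftYoneda.{u}.map_injective (congrArg Subtype.val h))⟩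
  have : F.Full := ⟨fun {x y} f ↦ ⟨⟨uliftYoneda.{u}.preimage f.1, by
      have h : q.map f.1 x.2 = y.2 := f.2
      rw [← uliftYoneda.{u}.map_preimage f.1] at h
      exact h⟩, Subtype.ext (uliftYoneda.{u}.map_preimage _)⟩⟩
  refine IsCofiltered.of_exists_of_isCofiltered_of_fullyFaithful F (fun ⟨P, t⟩ ↦ ?_)
  obtain ⟨X, f, s, hs⟩ := exists_uliftYoneda q t
  exact ⟨⟨X, s⟩, ⟨⟨f, hs⟩⟩⟩

variable {J}

lemma siteModel_uliftYoneda (q : (Cᵒᵖ ⥤ Type u) ⥤ Type u)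
    [PreservesColimitsOfSize.{u, u} q] [PreservesFiniteLimits q] (hq : J.W.IsInvertedBy q) :
    siteModel J (uliftYoneda.{u} (C := C) ⋙ q) := by
  refine ⟨isCofiltered_elements_uliftYoneda q, fun X R hR t ↦ ?_⟩
  let η := (uliftYonedaIsoShrinkYoneda.{u} (C := C)).symm.app X
  let i := (Sieve.shrinkFunctor.{u} R).ι
  have hi : IsIso (q.map i) := hq _ (Sieve.W_shrinkFunctor_ι_of_mem.{u} J R hR)
  have hsurj : Function.Surjective (q.map i) := (isIso_iff_bijective _).1 hi |>.2
  obtain ⟨s, hs⟩ := hsurj (q.map η.inv t)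
  obtain ⟨Y, f, s, rfl⟩ := exists_uliftYoneda q s
  let g : Y ⟶ X := uliftYoneda.{u}.preimage (f ≫ i ≫ η.hom)
  have hg : uliftYoneda.{u}.map g = f ≫ i ≫ η.hom := uliftYoneda.{u}.map_preimage _
  refine ⟨Y, g, ?_, s, ?_⟩
  · have h₁ := (f.app (op Y) ⟨𝟙 Y⟩).2
    have h₂ : shrinkYonedaObjObjEquiv (f.app (op Y) ⟨𝟙 Y⟩).1 = g := by
      have := congrArg ULift.down (ConcreteCategory.congr_hom (congr_app hg (op Y)) ⟨𝟙 Y⟩)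
      exact this.symm.trans (Category.id_comp g)
    rw [← h₂]
    exact h₁
  · change q.map (uliftYoneda.{u}.map g) s = t
    rw [hg, q.map_comp, q.map_comp]
    change q.map η.hom (q.map i (q.map f s)) = t
    rw [hs]
    change (q.map η.inv ≫ q.map η.hom) t = t
    rw [← q.map_comp, η.inv_hom_id, q.map_id]
    rfl

variable {E : Type (u + 1)} [Category.{u} E] (e : E ≌ Sheaf J (Type u))

/-- Restriction of a point along a site of definition. -/
noncomputable def restrict : PointCat E ⥤ (siteModel J).FullSubcategory :=
  (siteModel J).lift ((isPoint E).ι ⋙ (Functor.whiskeringLeft _ _ _).obj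
      (presheafToSheaf J (Type u) ⋙ e.inverse) ⋙
      (Functor.whiskeringLeft _ _ _).obj (uliftYoneda.{u} (C := C))) (fun p ↦
    siteModel_uliftYoneda ((presheafToSheaf J (Type u) ⋙ e.inverse) ⋙ p.obj) (by
      have := Localization.inverts (presheafToSheaf J (Type u) ⋙ e.inverse) J.W
      intro X Y f hf
      have := this f hf
      exact inferInstanceAs (IsIso (p.obj.map ((presheafToSheaf J (Type u) ⋙ e.inverse).map f)))))

lemma restrict_map_bijective (p p' : PointCat E) :
    Function.Bijective ((restrict e).map : (p ⟶ p') → _) := by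
  have h₁ := (Localization.fullyFaithfulWhiskeringLeft (presheafToSheaf J (Type u) ⋙ e.inverse)
    J.W (Type u)).map_bijective p.obj p'.obj
  have h₂ := bijective_whiskerLeft_uliftYoneda
    ((presheafToSheaf J (Type u) ⋙ e.inverse) ⋙ p.obj)
    ((presheafToSheaf J (Type u) ⋙ e.inverse) ⋙ p'.obj)
  have h₃ := (isPoint E).fullyFaithfulι.map_bijective p p'
  have h₄ := (siteModel J).fullyFaithfulι.map_bijective ((restrict e).obj p) ((restrict e).obj p')
  rw [← Function.Bijective.of_comp_iff' h₄]
  exact (h₂.comp h₁).comp h₃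

instance : (restrict e).Faithful := ⟨fun h ↦ (restrict_map_bijective e _ _).1 h⟩

instance : (restrict e).Full := ⟨fun f ↦ (restrict_map_bijective e _ _).2 f⟩

instance : (restrict e).EssSurj where
  mem_essImage F := by
    have := F.property.1
    let Φ : J.Point := { fiber := F.obj
                         initiallySmall := initiallySmall_of_essentiallySmall _
                         jointly_surjective := fun R hR x ↦ F.property.2 R hR x }
    let s : Sheaf J (Type u) ⥤ Type u := Φ.sheafFiber
    have hs : PreservesColimitsOfSize.{u, u} s := inferInstance
    let p : PointCat E := ⟨e.functor ⋙ s, inferInstance, inferInstance⟩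
    refine ⟨p, ⟨(siteModel J).isoMk ?_⟩⟩
    refine Functor.isoWhiskerLeft uliftYoneda.{u} (Functor.isoWhiskerLeft (presheafToSheaf J (Type u))
      (Functor.isoWhiskerRight e.counitIso s ≪≫ s.leftUnitor) ≪≫
        Φ.presheafToSheafCompSheafFiberIso (Type u)) ≪≫
      Functor.isoWhiskerRight uliftYonedaIsoShrinkYoneda.{u} _ ≪≫
      ?_
    exact Φ.shrinkYonedaCompPresheafFiberIso

end

lemma isAccessible {E : Type (u + 1)} [Category.{u} E]
    (h : ∃ (C : Type u) (_ : SmallCategory C) (J : GrothendieckTopology C),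
      Nonempty (E ≌ Sheaf J (Type u))) : IsAccessibleCategory.{u} (PointCat E) := by
  obtain ⟨C, _, J, ⟨e⟩⟩ := h
  have := isAccessibleCategory_siteModel J
  have : (restrict e).IsEquivalence := { }
  exact (restrict e).asEquivalence.symm.isAccessibleCategory

end PointCat

/-- The functor between categories of points induced by a geometric morphism. -/
def Topos.Hom.onPoints {E F : Topos.{u}} (f : E ⟶ F) : PointCat E.carrier ⥤ PointCat F.carrier :=
  (isPoint F.carrier).lift
    ((isPoint E.carrier).ι ⋙ (Functor.whiskeringLeft _ _ _).obj (Hom.inverse f)) (fun p ↦ by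
      have : PreservesColimitsOfSize.{u, u} (Hom.inverse f) :=
        (Hom.adj f).leftAdjoint_preservesColimits
      exact ⟨inferInstanceAs (PreservesColimitsOfSize.{u, u} (Hom.inverse f ⋙ p.obj)),
        inferInstanceAs (PreservesFiniteLimits (Hom.inverse f ⋙ p.obj))⟩)

instance {E F : Topos.{u}} (f : E ⟶ F) :
    PreservesFilteredColimitsOfSize.{u, u} (Topos.Hom.onPoints f) where
  preserves_filtered_colimits I _ _ := by
    have : PreservesColimitsOfShape I (Topos.Hom.onPoints f ⋙ (isPoint F.carrier).ι) :=
      inferInstanceAs (PreservesColimitsOfShape I ((isPoint E.carrier).ι ⋙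
        (Functor.whiskeringLeft _ _ _).obj (Topos.Hom.inverse f)))
    exact preservesColimitsOfShape_of_reflects_of_preserves _ (isPoint F.carrier).ι

/-- The category of points of a topos, as an accessible category with directed colimits. -/
abbrev Topos.ptObj (E : Topos.{u}) : AccCat.{u} where
  carrier := PointCat E.carrier
  isAccessible := PointCat.isAccessible E.isTopos

/-- The 1-cell of accessible categories induced by a geometric morphism. -/
abbrev Topos.ptMap {E F : Topos.{u}} (f : E ⟶ F) : E.ptObj ⟶ F.ptObj :=
  ({ functor := Topos.Hom.onPoints f } : AccCat.Hom E.ptObj F.ptObj)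

lemma Topos.ptObj_hom₂_ext {A : AccCat.{u}} {E : Topos.{u}} {F G : A ⟶ E.ptObj} {α β : F ⟶ G}
    (h : ∀ (a : A.carrier) (X : E.carrier), ((AccCat.Hom₂.nat α).app a).hom.app X =
      ((AccCat.Hom₂.nat β).app a).hom.app X) : α = β :=
  AccCat.hom₂_ext (NatTrans.ext (funext fun a ↦ ObjectProperty.hom_ext _
    (NatTrans.ext (funext fun X ↦ h a X))))

/-- The 2-functor of points `pt : Topoi ⥤ Acc_ω`. -/
def toposPt : Topos.{u} ⥤ᵖ AccCat.{u} where
  obj E := E.ptObj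
  map f := Topos.ptMap f
  map₂ {E F f g} α := (⟨
    { app := fun p ↦ (isPoint F.carrier).homMk (Functor.whiskerRight (Topos.Hom₂.nat α) p.obj)
      naturality := fun p q t ↦ by
        ext X : 3
        exact (t.hom.naturality _).symm }⟩ : AccCat.Hom₂ (Topos.ptMap f) (Topos.ptMap g))
  mapId E := AccCat.isoMk (F := Topos.ptMap (𝟙 E)) (G := 𝟙 E.ptObj)
    (NatIso.ofComponents (fun p ↦ (isPoint E.carrier).isoMk p.obj.leftUnitor) (fun t ↦ by
      ext X : 3
      exact (Category.comp_id _).trans (Category.id_comp _).symm))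
  mapComp {E F G} f g := AccCat.isoMk (F := Topos.ptMap (f ≫ g))
    (G := Topos.ptMap f ≫ Topos.ptMap g)
    (NatIso.ofComponents (fun p ↦ (isPoint G.carrier).isoMk
      (Functor.associator (Topos.Hom.inverse g) (Topos.Hom.inverse f) p.obj)) (fun t ↦ by
      ext X : 3
      exact (Category.comp_id _).trans (Category.id_comp _).symm))
  map₂_id f := Topos.ptObj_hom₂_ext (fun p X ↦ p.obj.map_id _)
  map₂_comp α β := Topos.ptObj_hom₂_ext (fun p X ↦ p.obj.map_comp _ _)
  map₂_whisker_left f _ _ η := Topos.ptObj_hom₂_ext (fun p X ↦ rfl)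
  map₂_whisker_right η h := Topos.ptObj_hom₂_ext (fun p X ↦ rfl)
  map₂_associator f g h := Topos.ptObj_hom₂_ext (fun p X ↦ p.obj.map_id _)
  map₂_left_unitor f := Topos.ptObj_hom₂_ext (fun p X ↦ p.obj.map_id _)
  map₂_right_unitor f := Topos.ptObj_hom₂_ext (fun p X ↦ p.obj.map_id _)

open scoped Pseudofunctor.StrongTrans

/-! A point of `Sh(L)` is determined by its restriction to the representable sheaves, which is a
flat continuous functor `F : L ⥤ Type u`; the functor `PointCat.restrict` makes this correspondence
an equivalence of categories. The decisive fact is that over a frame such an `F` has at most one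
element in each value (`siteModel.subsingleton`). By flatness two elements of `F a` are images of
one element under two arrows `c ⟶ a`, and in a poset these arrows coincide. Hence `F` carries no
more information than the set of `a` with `F a` nonempty. Functoriality and flatness make this set a
filter, and continuity makes it completely prime, so it is a point of `L` (`siteModel.toPT`);
conversely, every point of `L` arises in this way (`Locale.PT.siteModel_toFunctor`). Natural
transformations between such functors are unique, and exist exactly when the filters are included in
one another. So `PointCat.toPTFunctor` is fully faithful and essentially surjective.

For pseudonaturality, let `φ` be the frame homomorphism of a map of locales. The image of a point
`p` under the induced geometric morphism contains `a` when `p` is inhabited at the inverse image of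
the sheaf represented by `a`. That sheaf and the one represented by `φ a` map to each other, so the
condition says that `p` contains `φ a` (`PointCat.toPT_onPoints`). No coherence has to be computed:
all the categories of points involved are thin, so parallel 2-cells into them agree. An equivalence
for each locale and an invertible 2-cell for each morphism then suffice
(`Pseudofunctor.equivalenceOfSubsingleton`). -/

/-! ### Equivalences of locally thin pseudofunctors -/

section LocallyThin

universe w₁ w₂ v₁ v₂ u₁ u₂

variable {B : Type u₁} [Bicategory.{w₁, v₁} B] {C : Type u₂} [Bicategory.{w₂, v₂} C]

/-- A strong transformation to a pseudofunctor such that any two parallel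
2-cells into its values are equal. -/
def CategoryTheory.Pseudofunctor.StrongTrans.mkOfSubsingleton {F G : B ⥤ᵖ C}
    (hG : ∀ (X : C) (b : B) (f g : X ⟶ G.obj b), Subsingleton (f ⟶ g))
    (app : ∀ b, F.obj b ⟶ G.obj b)
    (naturality : ∀ {a b : B} (f : a ⟶ b), F.map f ≫ app b ≅ app a ≫ G.map f) :
    F ⟶ G :=
  ({ app := app
     naturality := naturality
     naturality_naturality := fun _ ↦ (hG _ _ _ _).elim _ _
     naturality_id := fun _ ↦ (hG _ _ _ _).elim _ _
     naturality_comp := fun _ _ ↦ (hG _ _ _ _).elim _ _ } : Pseudofunctor.StrongTrans F G)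

/-- Two locally thin pseudofunctors are equivalent if there is a pseudonatural family of equivalences
between their values. -/
def CategoryTheory.Pseudofunctor.equivalenceOfSubsingleton {F G : B ⥤ᵖ C}
    (hF : ∀ (X : C) (b : B) (f g : X ⟶ F.obj b), Subsingleton (f ⟶ g))
    (hG : ∀ (X : C) (b : B) (f g : X ⟶ G.obj b), Subsingleton (f ⟶ g))
    (e : ∀ b, Bicategory.Equivalence (G.obj b) (F.obj b))
    (naturality : ∀ {a b : B} (f : a ⟶ b), G.map f ≫ (e b).hom ≅ (e a).hom ≫ F.map f) :
    Bicategory.Equivalence F G where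
  -- The naturality cell of the inverses is the mate of the given one: insert the inverse of the
  -- counit of `e a`, apply the inverse of `naturality f`, and cancel `e b` against its inverse
  -- using the unit.
  hom := Pseudofunctor.StrongTrans.mkOfSubsingleton hG (fun b ↦ (e b).inv) (fun {a b} f ↦
    (λ_ _).symm ≪≫ whiskerRightIso (e a).counit.symm _ ≪≫ α_ _ _ _ ≪≫
      whiskerLeftIso _ ((α_ _ _ _).symm ≪≫ whiskerRightIso (naturality f).symm _ ≪≫ α_ _ _ _ ≪≫
        whiskerLeftIso _ (e b).unit.symm ≪≫ ρ_ _))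
  inv := Pseudofunctor.StrongTrans.mkOfSubsingleton hF (fun b ↦ (e b).hom) naturality
  -- Each `e b` runs from `G` to `F`, against the direction of `hom`, so units and counits exchange
  -- roles.
  unit := Pseudofunctor.StrongTrans.isoMk (fun b ↦ (e b).counit.symm)
    (fun _ ↦ (hF _ _ _ _).elim _ _)
  counit := Pseudofunctor.StrongTrans.isoMk (fun b ↦ (e b).unit.symm)
    (fun _ ↦ (hG _ _ _ _).elim _ _)
  left_triangle := Iso.ext (Pseudofunctor.StrongTrans.homCategory.ext
    fun _ ↦ (hG _ _ _ _).elim _ _)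

end LocallyThin

/-! ### Flat continuous functors on a frame and its points -/

/-- Flatness gives a common preimage of `x` and `y` along two arrows into `a`, and parallel arrows
in a poset are equal. All thinness on the topos side rests on this. -/
lemma siteModel.subsingleton {L : Type u} [Order.Frame L] {F : L ⥤ Type u}
    (hF : siteModel (frameTopology L) F) (a : L) : Subsingleton (F.obj a) where
  allEq x y := by
    obtain ⟨Z, f, g, z, rfl, rfl⟩ := ((siteModel_iff _ F).1 hF).2.1 x y
    rw [Subsingleton.elim f g]

/-- The point of a locale attached to a flat continuous functor on the underlying frame. -/
def siteModel.toPT {L : Type u} [Order.Frame L] {F : L ⥤ Type u}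
    (hF : siteModel (frameTopology L) F) : Locale.PT L where
  toFun a := Nonempty (F.obj a)
  map_inf' a b := by
    apply propext
    constructor
    · rintro ⟨x⟩
      exact ⟨⟨F.map (homOfLE inf_le_left) x⟩, ⟨F.map (homOfLE inf_le_right) x⟩⟩
    · rintro ⟨⟨x⟩, ⟨y⟩⟩
      -- The common preimage lives at some `Z` below both `a` and `b`, hence below `a ⊓ b`, and can
      -- be pushed forward to it.
      obtain ⟨Z, f, g, z, -, -⟩ := ((siteModel_iff _ F).1 hF).2.1 x y
      exact ⟨F.map (homOfLE (le_inf (leOfHom f) (leOfHom g))) z⟩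
  map_top' := by
    apply propext
    obtain ⟨X, ⟨x⟩⟩ := ((siteModel_iff _ F).1 hF).1
    exact ⟨fun _ ↦ trivial, fun _ ↦ ⟨F.map (homOfLE le_top) x⟩⟩
  map_sSup' S := by
    apply propext
    simp only [sSup_image, iSup_Prop_eq]
    constructor
    · rintro ⟨x⟩
      -- Continuity speaks of sieves, so `S` is replaced by the sieve it generates; an element over
      -- a member of that sieve is then pushed forward to some `s ∈ S`.
      let R : Sieve (sSup S) :=
        { arrows := fun V _ ↦ ∃ s ∈ S, V ≤ s
          downward_closed := fun ⟨s, hs, h⟩ g ↦ ⟨s, hs, (leOfHom g).trans h⟩ }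
      have hR : R ∈ frameTopology L (sSup S) := by
        rw [mem_frameTopology]
        refine le_antisymm (sSup_le fun _ ⟨f, _⟩ ↦ leOfHom f) (sSup_le fun s hs ↦ ?_)
        exact le_sSup ⟨homOfLE (le_sSup hs), s, hs, le_rfl⟩
      obtain ⟨Y, f, ⟨s, hs, h⟩, y, -⟩ := hF.2 R hR x
      exact ⟨s, hs, ⟨F.map (homOfLE h) y⟩⟩
    · rintro ⟨s, hs, ⟨x⟩⟩
      exact ⟨F.map (homOfLE (le_sSup hs)) x⟩

/-- The flat continuous functor attached to a point of a locale. -/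
def Locale.PT.toFunctor {L : Type u} [Order.Frame L] (x : Locale.PT L) : L ⥤ Type u where
  obj a := ULift (PLift (x a))
  map f := ↾fun t ↦ ⟨⟨OrderHomClass.mono x (leOfHom f) t.down.down⟩⟩

/-- Each clause of `siteModel_iff` matches a property of a frame homomorphism: preservation of `⊤`,
of binary meets and of suprema. The clause on parallel arrows is automatic in a poset. -/
lemma Locale.PT.siteModel_toFunctor {L : Type u} [Order.Frame L] (x : Locale.PT L) :
    siteModel (frameTopology L) x.toFunctor := by
  rw [siteModel_iff]
  refine ⟨⟨⊤, ⟨⟨⟨by rw [map_top]; trivial⟩⟩⟩⟩, fun a b s t ↦ ?_, fun a b f g s _ ↦ ?_,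
    fun a R hR s ↦ ?_⟩
  · exact ⟨a ⊓ b, homOfLE inf_le_left, homOfLE inf_le_right,
      ⟨⟨by rw [map_inf]; exact ⟨s.down.down, t.down.down⟩⟩⟩, rfl, rfl⟩
  · exact ⟨a, 𝟙 a, s, Subsingleton.elim _ _, rfl⟩
  · have h := s.down.down
    -- Writing `a` as the supremum of the members of `R` turns truth of `x` at `a` into truth at
    -- some member.
    rw [← (mem_frameTopology R).1 hR, map_sSup, sSup_image, iSup_Prop_eq] at h
    simp only [iSup_Prop_eq] at h
    obtain ⟨b, ⟨f, hf⟩, hb⟩ := h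
    exact ⟨b, f, hf, ⟨⟨hb⟩⟩, rfl⟩

/-! ### Points of the topos of sheaves on a frame -/

namespace PointCat

section

variable {L : Type u} [Order.Frame L]

/-- The sheaf represented by an element of a frame. -/
noncomputable abbrev representable (a : L) : Sheaf (frameTopology L) (Type u) :=
  (presheafToSheaf (frameTopology L) (Type u)).obj (uliftYoneda.{u}.obj a)

/-- Sheafification adjunction followed by Yoneda. Only nonemptiness is recorded, since the filter of
a point sees nothing more. -/
lemma nonempty_representable_hom_iff (a : L) (F : Sheaf (frameTopology L) (Type u)) :
    Nonempty (representable a ⟶ F) ↔ Nonempty (F.obj.obj (op a)) :=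
  (((sheafificationAdjunction (frameTopology L) (Type u)).homEquiv _ _).trans
    uliftYonedaEquiv).nonempty_congr

/-- The flat continuous functor attached to a point of the topos of sheaves on a frame. -/
noncomputable abbrev model (p : PointCat (Sheaf (frameTopology L) (Type u))) :
    (siteModel (frameTopology L)).FullSubcategory :=
  (restrict CategoryTheory.Equivalence.refl).obj p

/-- The point of a frame attached to a point of its topos of sheaves. -/
noncomputable def toPT (p : PointCat (Sheaf (frameTopology L) (Type u))) : Locale.PT L :=
  (model p).property.toPT

lemma siteModel_hom_subsingleton (F G : (siteModel (frameTopology L)).FullSubcategory) :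
    Subsingleton (F ⟶ G) where
  allEq α β := by
    ext a x
    exact (G.property.subsingleton a).elim _ _

instance (p q : PointCat (Sheaf (frameTopology L) (Type u))) : Subsingleton (p ⟶ q) :=
  have := siteModel_hom_subsingleton (model p) (model q)
  (restrict CategoryTheory.Equivalence.refl).map_injective.subsingleton

lemma toPT_mono {p q : PointCat (Sheaf (frameTopology L) (Type u))} (f : p ⟶ q) :
    toPT p ≤ toPT q :=
  fun _ ⟨x⟩ ↦ ⟨f.hom.app _ x⟩

/-- The inclusion of filters provides a component at each `a` by choice. Naturality is free because
the values are subsingletons, and fullness of `restrict` lifts the transformation to the points of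
the topos. -/
lemma nonempty_hom_of_le {p q : PointCat (Sheaf (frameTopology L) (Type u))}
    (h : toPT p ≤ toPT q) : Nonempty (p ⟶ q) := by
  let α : model p ⟶ model q := (siteModel (frameTopology L)).homMk
    { app := fun a ↦ ↾fun x ↦ (h a ⟨x⟩).some
      naturality := fun a b f ↦ by
        ext x
        exact ((model q).property.subsingleton b).elim _ _ }
  exact ⟨(restrict CategoryTheory.Equivalence.refl).preimage α⟩

/-- The functor sending a point of the topos of sheaves on a frame to a point of the frame. -/
noncomputable def toPTFunctor :
    PointCat (Sheaf (frameTopology L) (Type u)) ⥤ Locale.PT L where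
  obj := toPT
  map f := homOfLE (toPT_mono f)

instance : (toPTFunctor (L := L)).Faithful := ⟨fun _ ↦ Subsingleton.elim _ _⟩

instance : (toPTFunctor (L := L)).Full :=
  ⟨fun f ↦ ⟨(nonempty_hom_of_le (leOfHom f)).some, Subsingleton.elim _ _⟩⟩

instance : (toPTFunctor (L := L)).EssSurj where
  mem_essImage x := by
    let F : (siteModel (frameTopology L)).FullSubcategory := ⟨x.toFunctor, x.siteModel_toFunctor⟩
    let R : PointCat (Sheaf (frameTopology L) (Type u)) ⥤ _ :=
      restrict CategoryTheory.Equivalence.refl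
    let i : R.obj (R.objPreimage F) ≅ F := R.objObjPreimageIso F
    -- The components of `i` in both directions show that the two filters have the same members; in
    -- a poset the required isomorphism is an equality.
    refine ⟨R.objPreimage F, ⟨eqToIso (le_antisymm ?_ ?_)⟩⟩
    · rintro a ⟨s⟩
      exact (i.hom.hom.app a s).down.down
    · intro a h
      exact ⟨i.inv.hom.app a ⟨⟨h⟩⟩⟩

instance : (toPTFunctor (L := L)).IsEquivalence where

end

/-! ### Compatibility with morphisms of locales -/

/-- Inverse images preserve representables up to maps in both directions. -/
lemma nonempty_sheafPullback_representable_iff {L M : Type u} [Order.Frame L] [Order.Frame M]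
    (φ : FrameHom M L) (p : PointCat (Sheaf (frameTopology L) (Type u))) (a : M) :
    Nonempty (p.obj.obj ((φ.toFunctor.sheafPullback (Type u) (frameTopology M)
      (frameTopology L)).obj (representable a))) ↔
    Nonempty (p.obj.obj (representable (φ a))) := by
  let adj := φ.toFunctor.sheafAdjunctionContinuous (Type u) (frameTopology M) (frameTopology L)
  have h₁ : Nonempty ((φ.toFunctor.sheafPullback (Type u) (frameTopology M)
      (frameTopology L)).obj (representable a) ⟶ representable (φ a)) := by
    -- After transposition, a section at `a` of the direct image of `representable (φ a)` is needed.
    -- This is a section of `representable (φ a)` at `φ a`, and the identity supplies one.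
    rw [(adj.homEquiv _ _).nonempty_congr, nonempty_representable_hom_iff]
    exact (nonempty_representable_hom_iff (φ a) _).1 ⟨𝟙 _⟩
  have h₂ : Nonempty (representable (φ a) ⟶ (φ.toFunctor.sheafPullback (Type u) (frameTopology M)
      (frameTopology L)).obj (representable a)) := by
    -- A section at `φ a` of the inverse image is a section at `a` of its direct image, and the unit
    -- of the adjunction corresponds to one.
    rw [nonempty_representable_hom_iff]
    exact (nonempty_representable_hom_iff a _).1 ⟨adj.unit.app _⟩
  obtain ⟨f⟩ := h₁
  obtain ⟨g⟩ := h₂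
  exact ⟨fun ⟨x⟩ ↦ ⟨p.obj.map f x⟩, fun ⟨x⟩ ↦ ⟨p.obj.map g x⟩⟩

end PointCat

/-- By definition `a` belongs to `toPT p` when `p` is inhabited at `representable a`, so the
comparison of representables applies pointwise. Being an equality in a poset, this provides the
naturality 2-cells. -/
lemma PointCat.toPT_onPoints {L M : Locale.{u}} (f : L ⟶ M)
    (p : PointCat (Sheaf (frameTopology L.unop) (Type u))) :
    PointCat.toPT ((Topos.Hom.onPoints (Locale.sheafMap f)).obj p) =
      (PointCat.toPT p).comp f.unop.hom := by
  ext a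
  exact PointCat.nonempty_sheafPullback_representable_iff f.unop.hom p a

/-! ### Assembly in `Acc_ω` -/

instance CategoryTheory.Functor.preservesFilteredColimitsOfSize_of_isEquivalence {C D : Type*} [Category* C] [Category* D]
    (F : C ⥤ D) [F.IsEquivalence] : PreservesFilteredColimitsOfSize.{u, u} F :=
  ⟨fun _ _ _ ↦ inferInstance⟩

/-- An equivalence of categories, viewed as an equivalence in `Acc_ω`, provided that its target
is thin. -/
def AccCat.equivalenceOfSubsingleton {A B : AccCat.{u}} (e : A.carrier ≌ B.carrier)
    [∀ X Y : B.carrier, Subsingleton (X ⟶ Y)] : Bicategory.Equivalence A B where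
  hom := ({ functor := e.functor } : AccCat.Hom A B)
  inv := ({ functor := e.inverse } : AccCat.Hom B A)
  unit := AccCat.isoMk e.unitIso
  counit := AccCat.isoMk e.counitIso
  left_triangle := by
    ext X
    exact Subsingleton.elim (α := ((_ : B.carrier) ⟶ _)) _ _

/-- The equivalence between the points of a locale and the points of its topos of sheaves. -/
noncomputable def Locale.ptEquivalence (L : Locale.{u}) :
    Bicategory.Equivalence L.sheafTopos.ptObj L.ptObj.toAccCat :=
  AccCat.equivalenceOfSubsingleton (A := L.sheafTopos.ptObj) (B := L.ptObj.toAccCat)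
    -- `AsSmall.equiv` only raises universes, matching the way `i` views a poset as a category.
    (PointCat.toPTFunctor.asEquivalence.trans AsSmall.equiv)

/-- Thinness of the category of points passes to natural transformations componentwise. This is the
local thinness of `pt ∘ Sh` that disposes of its coherence conditions. -/
lemma PointCat.hom₂_subsingleton {A : AccCat.{u}} (L : Locale.{u}) (F G : A ⟶ L.sheafTopos.ptObj) :
    Subsingleton (F ⟶ G) where
  allEq _ _ := AccCat.hom₂_ext (NatTrans.ext (funext fun _ ↦
    Subsingleton.elim (α := (_ : PointCat (Sheaf (frameTopology L.unop) (Type u))) ⟶ _) _ _))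

/-- The equivalences between points of locales and points of sheaf topoi are pseudonatural. -/
noncomputable def Locale.ptEquivalenceNaturality {L M : Locale.{u}} (f : L ⟶ M) :
    Topos.ptMap (Locale.sheafMap f) ≫ M.ptEquivalence.hom ≅
      L.ptEquivalence.hom ≫ (locPt.toPseudofunctor.comp posToAcc).map f.toLoc :=
  AccCat.isoMk (NatIso.ofComponents
    (fun p ↦ eqToIso (congrArg ULift.up (PointCat.toPT_onPoints f p)))
    (fun _ ↦ ULift.ext _ _ (Subsingleton.elim _ _)))

/-- The square formed by `Sh : Loc ⥤ Topoi`, `pt : Topoi ⥤ Acc_ω`, `pt : Loc ⥤ Pos_ω` and the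
inclusion `i : Pos_ω ⥤ Acc_ω` commutes up to equivalence of pseudofunctors; in particular the poset
of points of a locale is equivalent to the category of points of its topos of sheaves. -/
theorem mainTheorem7 :
    Nonempty (Bicategory.Equivalence (locPt.{u}.toPseudofunctor.comp posToAcc.{u})
      (locSheaf.{u}.comp toposPt.{u})) ∧
    ∀ L : Locale.{u},
      Nonempty (Locale.PT L.unop ≌ PointCat (Sheaf (frameTopology L.unop) (Type u))) := by
  refine ⟨⟨Pseudofunctor.equivalenceOfSubsingleton
    (fun _ _ _ _ ↦ ⟨DirPos.hom₂_subsingleton⟩)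
    (fun _ L _ _ ↦ PointCat.hom₂_subsingleton L.as _ _)
    (fun L ↦ L.as.ptEquivalence)
    (fun f ↦ Locale.ptEquivalenceNaturality f.as)⟩, fun L ↦ ?_⟩
  -- The objectwise claim uses the same equivalence, without the universe lift.
  exact ⟨PointCat.toPTFunctor.asEquivalence.symm⟩
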